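/- Let $n\ge 1$ and let $C\subset\mathbb R^n$ be a closed convex cone that contains no line and has nonempty interior. Put $C^\circ=\{y:\langle x,y\rangle\le 0 \text{ for all } x\in C\}$ and $\Omega=\operatorname{int}C^\circ\cap S^{n-1}$. Let $e_1,\dots,e_n$ be an orthonormal basis of $\mathbb R^n$ such that $u_*=-e_1$ lies in $\operatorname{int}C$ and, for some $\xi>0$, $\langle u,u_*\rangle>\xi$ for all $u\in C\cap S^{n-1}$ and $\langle v,u_*\rangle<-\xi$ for all $v\in C^\circ\cap S^{n-1}$. Write points of $\mathbb R^n$ in this basis as $(t,x)\in\mathbb R\times\mathbb R^{n-1}$, and let $\Phi(x)=(1,x)/\sqrt{1+|x|^2}$ for $x\in\mathbb R^{n-1}$. A nonempty closed convex set $K\subset\mathbb R^n$ is a pseudo cone if $\lambda x\in K$ for all $x\in K$, $\lambda\ge 1$. It is $C$-asymptotic if it is a pseudo cone, its recession cone $\{y: x+\lambda y\in K\text{ for all }x\in K,\ \lambda\ge 1\}$ equals $C$, and $\operatorname{dist}(x,\partial C)\to 0$ as $|x|\to\infty$ with $x\in\partial K$. Let $h_K(y)=\sup_{x\in K}\langle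 x,y\rangle$ for $y\in C^\circ$, and for Borel $\eta\subset\Omega$ let $$S_K(\eta)=\mathcal H^{n-1}\big(\{x\in\partial K:\langle x,v\rangle=h_K(v)\text{ for some }v\in\eta\}\big).$$ Let $\mu$ be a locally finite Borel measure on $\Omega$, and set $\widetilde\mu(\widetilde\eta)=\int_{\Phi(\widetilde\eta)}|\langle v,e_1\rangle|\,d\mu(v)$ for Borel $\widetilde\eta\subset\Phi^{-1}(\Omega)$. If $K$ is $C$-asymptotic and $S_K=\mu$ on all Borel subsets of $\Omega$, then the function $$u:\overline{\Phi^{-1}(\Omega)}\to\mathbb R,\qquad u(x)=h_K(1,x),$$ is convex and continuous, satisfies $u=0$ on $\partial(\Phi^{-1}(\Omega))$, and solves $\mathcal M_u=\widetilde\mu$ on $\Phi^{-1}(\Omega)$, that is, for every Borel set $\Xi\subset\Phi^{-1}(\Omega)$, $$\mathcal M_u(\Xi):=\mathcal H^{n-1}\Big(\bigcup_{x\in\Xi}\partial u(x)\Big)=\widetilde\mu(\Xi),$$ where $\partial u(x)=\{p\in\mathbb R^{n-1}:u(z)\ge u(x)+\langle p,z-x\rangle\text{ for all }z\in\overline{\Phi^{-1}(\Omega)}\}$.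 -/

import Mathlib

open MeasureTheory Filter Topology
open scoped ENNReal RealInnerProductSpace

noncomputable section

namespace PseudoCone

section General

variable {E : Type*} [NormedAddCommGroup E] [InnerProductSpace ℝ E]

/-- The set contains no line that is infinite in both directions. -/
def ContainsNoLine (C : Set E) : Prop :=
  ∀ x v : E, v ≠ 0 → ∃ t : ℝ, x + t • v ∉ C

/-- The dual cone `C° = {y : ⟪x, y⟫ ≤ 0 for all x ∈ C}` (with the sign convention of the polar). -/
def dualCone (C : Set E) : Set E :=
  {y | ∀ x ∈ C, ⟪x, y⟫ ≤ 0}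

/-- `Ω = int C° ∩ S^{n-1}`. -/
def Omega (C : Set E) : Set E :=
  interior (dualCone C) ∩ Metric.sphere 0 1

/-- A pseudo cone: a nonempty closed convex set stable under dilations by factors `≥ 1`. -/
structure IsPseudoCone (K : Set E) : Prop where
  nonempty : K.Nonempty
  isClosed : IsClosed K
  convex : Convex ℝ K
  smul_mem : ∀ x ∈ K, ∀ r : ℝ, 1 ≤ r → r • x ∈ K

/-- The recession cone of `K`. -/
def recessionCone (K : Set E) : Set E :=
  {y | ∀ x ∈ K, ∀ r : ℝ, 1 ≤ r → x + r • y ∈ K}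

/-- `K` is `C`-pseudo: a pseudo cone whose recession cone is `C`. -/
def IsCPseudo (C K : Set E) : Prop :=
  IsPseudoCone K ∧ recessionCone K = C

/-- `K` is `C`-asymptotic: it is `C`-pseudo, and `dist(x, ∂C) → 0` as `|x| → ∞`, `x ∈ ∂K`. -/
def IsCAsymptotic (C K : Set E) : Prop :=
  IsCPseudo C K ∧
    Tendsto (fun x => Metric.infDist x (frontier C))
      (Bornology.cobounded E ⊓ 𝓟 (frontier K)) (𝓝 0)

/-- The support function `h_K(y) = sup_{x ∈ K} ⟪x, y⟫`. If `K` is `C`-pseudo then `K ⊆ C`, so that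
for `y ∈ C°` this is the supremum of a nonempty set of reals bounded above by `0`; it is used only
for such `y`. -/
def supportFunction (K : Set E) (y : E) : ℝ :=
  sSup ((fun x => ⟪x, y⟫) '' K)

/-- The inverse Gauss image `τ_K(η)`. -/
def inverseGaussImage (K η : Set E) : Set E :=
  {x | x ∈ frontier K ∧ ∃ v ∈ η, ⟪x, v⟫ = supportFunction K v}

/-- The surface area measure, `S_K(η) = ℋ^d(τ_K(η))` with `d = n - 1`, for Borel sets `η ⊆ Ω`;
here `μHE[d]` is Mathlib's (Euclidean normalized) `d`-dimensional Hausdorff measure. -/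
def surfaceArea [MeasurableSpace E] [BorelSpace E] (d : ℕ) (K η : Set E) : ℝ≥0∞ :=
  μHE[d] (inverseGaussImage K η)

/-- The subdifferential at `x` of a function `u` with domain `Λ`. -/
def subdifferential (Λ : Set E) (u : E → ℝ) (x : E) : Set E :=
  {p | ∀ z ∈ Λ, u x + ⟪p, z - x⟫ ≤ u z}

end General

section Coordinates

variable {m : ℕ}

/-- The Monge-Ampère measure of a function `u` with domain `Λ ⊆ ℝ^m`:
`M_u(Ξ) = ℋ^m(∂u(Ξ))`, where `∂u(Ξ) = ⋃_{x ∈ Ξ} ∂u(x)`, for Borel sets `Ξ ⊆ Λ`. -/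
def mongeAmpere (Λ : Set (EuclideanSpace ℝ (Fin m))) (u : EuclideanSpace ℝ (Fin m) → ℝ)
    (Ξ : Set (EuclideanSpace ℝ (Fin m))) : ℝ≥0∞ :=
  μHE[m] (⋃ x ∈ Ξ, subdifferential Λ u x)

/-- The choice of coordinates: `e` is an orthonormal basis whose first vector is `e_1 = -u_*`,
where `u_*` is a unit vector in the interior of `C` such that, for some `ξ > 0`,
`⟪u, u_*⟫ > ξ` on `C ∩ S^{n-1}` and `⟪v, u_*⟫ < -ξ` on `C° ∩ S^{n-1}`. -/
def IsAdaptedBasis (C : Set (EuclideanSpace ℝ (Fin (m + 1))))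
    (e : OrthonormalBasis (Fin (m + 1)) ℝ (EuclideanSpace ℝ (Fin (m + 1)))) : Prop :=
  -e 0 ∈ interior C ∧
    ∃ ξ : ℝ, 0 < ξ ∧
      (∀ u ∈ C ∩ Metric.sphere 0 1, ξ < ⟪u, -e 0⟫) ∧
      (∀ v ∈ dualCone C ∩ Metric.sphere 0 1, ⟪v, -e 0⟫ < -ξ)

/-- The point of `ℝ^{m+1}` with coordinates `(t, x) ∈ ℝ × ℝ^m` in the orthonormal basis `e`. -/
def point (e : OrthonormalBasis (Fin (m + 1)) ℝ (EuclideanSpace ℝ (Fin (m + 1))))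
    (t : ℝ) (x : EuclideanSpace ℝ (Fin m)) : EuclideanSpace ℝ (Fin (m + 1)) :=
  t • e 0 + ∑ i : Fin m, x i • e i.succ

/-- The map `Φ(x) = (1, x) / √(1 + |x|²)` from `ℝ^m` to the open hemisphere around `e_1`. -/
def Phi (e : OrthonormalBasis (Fin (m + 1)) ℝ (EuclideanSpace ℝ (Fin (m + 1))))
    (x : EuclideanSpace ℝ (Fin m)) : EuclideanSpace ℝ (Fin (m + 1)) :=
  (√(1 + ‖x‖ ^ 2))⁻¹ • point e 1 x

/-- The open set `Φ⁻¹(Ω) ⊆ ℝ^m`. -/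
def PhiDomain (C : Set (EuclideanSpace ℝ (Fin (m + 1))))
    (e : OrthonormalBasis (Fin (m + 1)) ℝ (EuclideanSpace ℝ (Fin (m + 1)))) :
    Set (EuclideanSpace ℝ (Fin m)) :=
  Phi e ⁻¹' Omega C

/-- The transported measure, `μ̃(η) = ∫_{Φ(η)} |⟪v, e_1⟫| dμ(v)`, for Borel sets `η ⊆ Φ⁻¹(Ω)`. -/
def muTilde {C : Set (EuclideanSpace ℝ (Fin (m + 1)))}
    (e : OrthonormalBasis (Fin (m + 1)) ℝ (EuclideanSpace ℝ (Fin (m + 1))))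
    (μ : Measure (Omega C)) (η : Set (EuclideanSpace ℝ (Fin m))) : ℝ≥0∞ :=
  ∫⁻ v in {v : Omega C | (v : EuclideanSpace ℝ (Fin (m + 1))) ∈ Phi e '' η},
    ENNReal.ofReal |⟪(v : EuclideanSpace ℝ (Fin (m + 1))), e 0⟫| ∂μ

/-- The function `u(x) = h_K(1, x)`. -/
def uFun (e : OrthonormalBasis (Fin (m + 1)) ℝ (EuclideanSpace ℝ (Fin (m + 1))))
    (K : Set (EuclideanSpace ℝ (Fin (m + 1)))) (x : EuclideanSpace ℝ (Fin m)) : ℝ :=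
  supportFunction K (point e 1 x)

end Coordinates

end PseudoCone

end

open PseudoCone

/-!
A subgradient of `u = h_K(1, ·)` at `x` is the projection along `e_1` of a point of the face of `K`
with outer normal `Φ(x)`, so `∂u(Ξ)` is the projection of `τ_K(Φ(Ξ))`, and the equation
`M_u = μ̃` is the area formula for the graph of a convex function. It needs no differentiability:
two points on faces with normals within `ε` of `v` span a chord that is orthogonal to `v` up to `ε`,
so near `v` the projection agrees up to a factor `1 + O(ε)` with that of the hyperplane `v^⊥`, which
scales `ℋ^m` by `⟪v, e_1⟫`. These local comparisons add up to an identity of measures because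
faces over disjoint sets of normals overlap in null sets, `S_K` being a locally finite measure.

On the boundary of `Φ⁻¹(Ω)` the normal `(1, x)` is orthogonal to some nonzero `w ∈ C`. Far out along
`w` the asymptotic condition puts points of `K` close to the ray of `w`, whence `h_K(1, x) = 0`.
-/

noncomputable section

namespace PseudoCone

theorem le_of_forall_mul_le_mul {f g : NNReal → NNReal} (hf : Continuous f) (hf₀ : f 0 = 1)
    (hg : Continuous g) (hg₀ : g 0 = 1) {a b : ℝ≥0∞}
    (h : ∀ κ, 0 < κ → κ < 1 → (f κ : ℝ≥0∞) * a ≤ g κ * b) : a ≤ b := by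
  have hlim {f : NNReal → NNReal} (hf : Continuous f) (hf₀ : f 0 = 1) (c : ℝ≥0∞) :
      Tendsto (fun κ => (f κ : ℝ≥0∞) * c) (𝓝[>] 0) (𝓝 c) := by
    have hf₁ : Tendsto f (𝓝[>] 0) (𝓝 1) := hf₀ ▸ hf.continuousWithinAt.tendsto
    simpa only [ENNReal.coe_one, one_mul] using
      ENNReal.Tendsto.mul_const (ENNReal.tendsto_coe.2 hf₁) (Or.inl one_ne_zero)
  refine le_of_tendsto_of_tendsto (hlim hf hf₀ a) (hlim hg hg₀ b) ?_
  filter_upwards [Ioo_mem_nhdsGT one_pos] with κ hκ using h κ hκ.1 hκ.2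

section MeasureComparison

variable {X : Type*} [TopologicalSpace X] [SecondCountableTopology X] [MeasurableSpace X]
  [OpensMeasurableSpace X]

theorem measure_le_of_forall_exists_nhds_le {μ ν : Measure X}
    (h : ∀ x, ∃ U ∈ 𝓝 x, ∀ s ⊆ U, MeasurableSet s → μ s ≤ ν s) : μ ≤ ν := by
  rcases isEmpty_or_nonempty X with hX | hX
  · exact (Measure.eq_zero_of_isEmpty μ).trans_le (Measure.zero_le ν)
  choose U hU hle using h
  obtain ⟨c, hc, hcover⟩ := TopologicalSpace.countable_cover_nhds
    fun x => interior_mem_nhds.2 (hU x)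
  obtain ⟨a, rfl⟩ := hc.exists_eq_range
    (Set.nonempty_iff_ne_empty.2 fun h => by simp [h, Set.empty_ne_univ] at hcover)
  have hsup : ⋃ n, disjointed (fun n => interior (U (a n))) n = Set.univ := by
    rw [iUnion_disjointed, ← hcover, Set.biUnion_range]
  have hdm (n) : MeasurableSet (disjointed (fun n => interior (U (a n))) n) :=
    MeasurableSet.disjointed (fun n => isOpen_interior.measurableSet) n
  have hsum (ρ : Measure X) (s) :
      ρ s = ∑' n, ρ.restrict (disjointed (fun n => interior (U (a n))) n) s := by
    rw [← Measure.sum_apply_of_countable, ← Measure.restrict_iUnion (disjoint_disjointed _) hdm,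
      hsup, Measure.restrict_univ]
  refine Measure.le_iff.2 fun s hs => ?_
  rw [hsum μ, hsum ν]
  refine ENNReal.tsum_le_tsum fun n => ?_
  rw [Measure.restrict_apply hs, Measure.restrict_apply hs]
  exact hle (a n) _ (Set.inter_subset_right.trans ((disjointed_subset _ n).trans interior_subset))
    (hs.inter (hdm n))

end MeasureComparison

section SetValuedMap

theorem isSigmaCompact_of_isOpen {X : Type*} [PseudoEMetricSpace X] [SigmaCompactSpace X]
    {U : Set X} (hU : IsOpen U) : IsSigmaCompact U := by
  obtain ⟨F, hF, -, rfl, -⟩ := hU.exists_iUnion_isClosed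
  exact isSigmaCompact_iUnion _ fun n =>
    isSigmaCompact_univ.of_isClosed_subset (hF n) (Set.subset_univ _)

variable {X Y : Type*} [MetricSpace X] [MeasurableSpace X] [BorelSpace X] [MeasurableSpace Y]
  {F : X → Set Y} {μ : Measure X} {ν : Measure Y}

theorem aedisjoint_biUnion_of_measure_biUnion_eq [IsFiniteMeasureOnCompacts μ]
    (hF : ∀ k, IsCompact k → MeasurableSet (⋃ x ∈ k, F x))
    (hμ : ∀ η, MeasurableSet η → ν (⋃ x ∈ η, F x) = μ η)
    {k l : Set X} (hk : IsCompact k) (hl : IsCompact l) (hkl : Disjoint k l) :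
    AEDisjoint ν (⋃ x ∈ k, F x) (⋃ x ∈ l, F x) := by
  have hunion : ν ((⋃ x ∈ k, F x) ∪ ⋃ x ∈ l, F x) = μ k + μ l := by
    rw [← Set.biUnion_union, hμ _ (hk.union hl).measurableSet, measure_union hkl hl.measurableSet]
  have hadd := measure_union_add_inter (μ := ν) (⋃ x ∈ k, F x) (hF l hl)
  rw [hunion, hμ k hk.measurableSet, hμ l hl.measurableSet] at hadd
  have hfin : μ k + μ l ≠ ∞ := ENNReal.add_ne_top.2 ⟨hk.measure_lt_top.ne, hl.measure_lt_top.ne⟩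
  exact (ENNReal.add_right_inj hfin).1 (hadd.trans (add_zero _).symm)

variable [SigmaCompactSpace X]

theorem nullMeasurableSet_biUnion_and_aedisjoint_compl
    (hF : ∀ k, IsCompact k → NullMeasurableSet (⋃ x ∈ k, F x) ν)
    (hd : ∀ k l, IsCompact k → IsCompact l → Disjoint k l →
      AEDisjoint ν (⋃ x ∈ k, F x) (⋃ x ∈ l, F x))
    {η : Set X} (hη : MeasurableSet η) :
    NullMeasurableSet (⋃ x ∈ η, F x) ν ∧ AEDisjoint ν (⋃ x ∈ η, F x) (⋃ x ∈ ηᶜ, F x) := by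
  have hσ : ∀ s, IsSigmaCompact s → NullMeasurableSet (⋃ x ∈ s, F x) ν := by
    rintro _ ⟨k, hk, rfl⟩
    rw [Set.biUnion_iUnion]
    exact NullMeasurableSet.iUnion fun i => hF _ (hk i)
  induction η, hη using MeasurableSet.induction_on_open with
  | isOpen U hU =>
    have hUσ := isSigmaCompact_of_isOpen hU
    refine ⟨hσ U hUσ, ?_⟩
    obtain ⟨k, hk, hkU⟩ := hUσ
    obtain ⟨l, hl, hlU⟩ := isSigmaCompact_univ.of_isClosed_subset hU.isClosed_compl
      (Set.subset_univ _)
    rw [← hlU, ← hkU, Set.biUnion_iUnion, Set.biUnion_iUnion]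
    refine AEDisjoint.iUnion_left_iff.2 fun i => AEDisjoint.iUnion_right_iff.2 fun j =>
      hd _ _ (hk i) (hl j) ?_
    exact disjoint_compl_right.mono (hkU ▸ Set.subset_iUnion k i) (hlU ▸ Set.subset_iUnion l j)
  | compl t ht ih =>
    rw [compl_compl]
    refine ⟨?_, ih.2.symm⟩
    have huniv : (⋃ x, F x) = (⋃ x ∈ t, F x) ∪ ⋃ x ∈ tᶜ, F x := by
      rw [← Set.biUnion_union, Set.union_compl_self, Set.biUnion_univ]
    have hG : NullMeasurableSet (⋃ x, F x) ν := by
      simpa only [Set.biUnion_univ] using hσ Set.univ isSigmaCompact_univ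
    refine (hG.diff ih.1).congr ?_
    rw [huniv, Set.union_sdiff_left]
    exact ih.2.symm.sdiff_ae_eq_left
  | iUnion f _ _ ih =>
    rw [Set.biUnion_iUnion]
    refine ⟨NullMeasurableSet.iUnion fun i => (ih i).1, AEDisjoint.iUnion_left_iff.2 fun i => ?_⟩
    exact (ih i).2.mono subset_rfl
      (Set.biUnion_mono (Set.compl_subset_compl.2 (Set.subset_iUnion f i)) fun _ _ => subset_rfl)

theorem exists_measure_eq_measure_biUnion
    (hF : ∀ k, IsCompact k → NullMeasurableSet (⋃ x ∈ k, F x) ν)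
    (hd : ∀ k l, IsCompact k → IsCompact l → Disjoint k l →
      AEDisjoint ν (⋃ x ∈ k, F x) (⋃ x ∈ l, F x)) :
    ∃ P : Measure X, ∀ η, MeasurableSet η → P η = ν (⋃ x ∈ η, F x) := by
  have key {η : Set X} := nullMeasurableSet_biUnion_and_aedisjoint_compl hF hd (η := η)
  refine ⟨Measure.ofMeasurable (fun η _ => ν (⋃ x ∈ η, F x)) (by simp) fun η hη hdisj => ?_,
    fun η hη => Measure.ofMeasurable_apply η hη⟩
  rw [Set.biUnion_iUnion]
  refine measure_iUnion₀ (fun i j hij => ?_) fun i => (key (hη i)).1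
  exact (key (hη i)).2.mono subset_rfl
    (Set.biUnion_mono (hdisj hij).subset_compl_left fun _ _ => subset_rfl)

end SetValuedMap

section Coordinates

variable {m : ℕ} (e : OrthonormalBasis (Fin (m + 1)) ℝ (EuclideanSpace ℝ (Fin (m + 1))))

/-- The orthogonal projection `(t, x) ↦ x` of `ℝ^{m+1}` along the first vector of the basis `e`; it
carries the faces of `K` to the subdifferentials of `uFun e K`. -/
def proj : EuclideanSpace ℝ (Fin (m + 1)) →L[ℝ] EuclideanSpace ℝ (Fin m) :=
  (EuclideanSpace.equiv (Fin m) ℝ).symm.toContinuousLinearMap ∘L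
    ContinuousLinearMap.pi fun i => innerSL ℝ (e i.succ)

/-- The embedding `x ↦ (0, x)` of `ℝ^m` as the hyperplane orthogonal to the first vector of `e`. -/
def embed : EuclideanSpace ℝ (Fin m) →ₗ[ℝ] EuclideanSpace ℝ (Fin (m + 1)) :=
  Fintype.linearCombination ℝ (fun i : Fin m => e i.succ) ∘ₗ
    (WithLp.linearEquiv 2 ℝ (Fin m → ℝ)).toLinearMap

@[simp]
theorem proj_apply (z : EuclideanSpace ℝ (Fin (m + 1))) (i : Fin m) :
    proj e z i = ⟪e i.succ, z⟫ := rfl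

theorem point_eq_smul_add_embed (t : ℝ) (x : EuclideanSpace ℝ (Fin m)) :
    point e t x = t • e 0 + embed e x := rfl

theorem inner_eq_coords (z w : EuclideanSpace ℝ (Fin (m + 1))) :
    ⟪z, w⟫ = ⟪z, e 0⟫ * ⟪w, e 0⟫ + ⟪proj e z, proj e w⟫ := by
  rw [← e.sum_inner_mul_inner z w, Fin.sum_univ_succ, real_inner_comm w]
  simp [PiLp.inner_apply, mul_comm]

theorem norm_sq_eq_coords (z : EuclideanSpace ℝ (Fin (m + 1))) :
    ‖z‖ ^ 2 = ⟪z, e 0⟫ ^ 2 + ‖proj e z‖ ^ 2 := by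
  rw [← real_inner_self_eq_norm_sq, inner_eq_coords e, real_inner_self_eq_norm_sq, ← sq]

@[simp]
theorem inner_point (t : ℝ) (x : EuclideanSpace ℝ (Fin m)) : ⟪point e t x, e 0⟫ = t := by
  simp [point, inner_add_left, inner_smul_left, sum_inner, e.inner_eq_ite]

@[simp]
theorem proj_point (t : ℝ) (x : EuclideanSpace ℝ (Fin m)) : proj e (point e t x) = x := by
  ext i
  simp [point, e.inner_eq_ite, Fin.succ_ne_zero]

theorem inner_point_right (z : EuclideanSpace ℝ (Fin (m + 1))) (t : ℝ)
    (x : EuclideanSpace ℝ (Fin m)) : ⟪z, point e t x⟫ = ⟪z, e 0⟫ * t + ⟪proj e z, x⟫ := by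
  rw [inner_eq_coords e, inner_point, proj_point]

theorem norm_point_one (x : EuclideanSpace ℝ (Fin m)) : ‖point e 1 x‖ = √(1 + ‖x‖ ^ 2) := by
  rw [← Real.sqrt_sq (norm_nonneg _), norm_sq_eq_coords e, inner_point, proj_point, one_pow]

theorem eq_of_inner_eq_of_proj_eq {z w : EuclideanSpace ℝ (Fin (m + 1))}
    (h₀ : ⟪z, e 0⟫ = ⟪w, e 0⟫) (h : proj e z = proj e w) : z = w := by
  rw [← sub_eq_zero, ← norm_eq_zero, ← sq_eq_zero_iff, norm_sq_eq_coords e, inner_sub_left, h₀,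
    map_sub, h]
  simp

theorem point_proj (z : EuclideanSpace ℝ (Fin (m + 1))) : point e ⟪z, e 0⟫ (proj e z) = z :=
  eq_of_inner_eq_of_proj_eq e (by simp) (by simp)

end Coordinates

section HausdorffMeasure

theorem euclideanHausdorffMeasure_image_le {X Y : Type*} [EMetricSpace X]
    [MeasurableSpace X] [BorelSpace X] [EMetricSpace Y] [MeasurableSpace Y] [BorelSpace Y]
    {f : X → Y} {A : Set X} {L : NNReal} (hf : LipschitzOnWith L f A) (d : ℕ) :
    μHE[d] (f '' A) ≤ (L : ℝ≥0∞) ^ d * μHE[d] A := by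
  simp only [Measure.euclideanHausdorffMeasure_def, Measure.smul_apply]
  rw [mul_smul_comm, ← ENNReal.rpow_natCast]
  gcongr
  exact hf.hausdorffMeasure_image_le d.cast_nonneg

theorem le_euclideanHausdorffMeasure_image {X Y : Type*} [EMetricSpace X]
    [MeasurableSpace X] [BorelSpace X] [EMetricSpace Y] [MeasurableSpace Y] [BorelSpace Y]
    {f : X → Y} {A : Set X} {L : NNReal} (hf : AntilipschitzWith L (A.domRestrict f)) (d : ℕ) :
    μHE[d] A ≤ (L : ℝ≥0∞) ^ d * μHE[d] (f '' A) := by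
  have h := hf.le_hausdorffMeasure_image d.cast_nonneg Set.univ
  rw [← isometry_subtype_coe.hausdorffMeasure_image (Or.inl d.cast_nonneg), Set.image_univ,
    Set.image_univ, Subtype.range_coe, Set.range_domRestrict, ENNReal.rpow_natCast] at h
  simp only [Measure.euclideanHausdorffMeasure_def, Measure.smul_apply]
  rw [mul_smul_comm]
  gcongr

variable {E : Type*} [NormedAddCommGroup E] [NormedSpace ℝ E] [MeasurableSpace E] [BorelSpace E]
  {f : E → E} {A : Set E} {κ : NNReal}

theorem euclideanHausdorffMeasure_image_le_of_approximatesLinearOn_id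
    (hf : ApproximatesLinearOn f (ContinuousLinearMap.id ℝ E) A κ) (d : ℕ) :
    μHE[d] (f '' A) ≤ ((1 + κ : NNReal) : ℝ≥0∞) ^ d * μHE[d] A :=
  euclideanHausdorffMeasure_image_le (lipschitzOnWith_iff_restrict.2 (hf.lipschitz.weaken
    (by gcongr; exact ContinuousLinearMap.norm_id_le))) d

theorem le_euclideanHausdorffMeasure_image_of_approximatesLinearOn_id [Nontrivial E] (hκ : κ < 1)
    (hf : ApproximatesLinearOn f (ContinuousLinearMap.id ℝ E) A κ) (d : ℕ) :
    ((1 - κ : NNReal) : ℝ≥0∞) ^ d * μHE[d] A ≤ μHE[d] (f '' A) := by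
  have hanti : AntilipschitzWith (1 - κ)⁻¹ (A.domRestrict f) := by
    have := ApproximatesLinearOn.antilipschitz (f' := ContinuousLinearEquiv.refl ℝ E) hf
      (Or.inr (by simpa using hκ))
    simpa using this
  have hpos : 1 - κ ≠ 0 := (tsub_pos_of_lt hκ).ne'
  calc ((1 - κ : NNReal) : ℝ≥0∞) ^ d * μHE[d] A
      ≤ ((1 - κ : NNReal) : ℝ≥0∞) ^ d *
          ((((1 - κ)⁻¹ : NNReal) : ℝ≥0∞) ^ d * μHE[d] (f '' A)) := by
        gcongr
        exact le_euclideanHausdorffMeasure_image hanti d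
    _ = μHE[d] (f '' A) := by
        rw [← mul_assoc, ← mul_pow, ← ENNReal.coe_mul, mul_inv_cancel₀ hpos, ENNReal.coe_one,
          one_pow, one_mul]

end HausdorffMeasure

section GraphMap

variable {m : ℕ} (e : OrthonormalBasis (Fin (m + 1)) ℝ (EuclideanSpace ℝ (Fin (m + 1))))

/-- The parametrization `p ↦ (-⟪b, p⟫, p)` of the hyperplane through the origin with normal
`(1, b)`. After `proj e` it is the oblique projection along `e 0` onto that hyperplane. -/
def graphMap (b : EuclideanSpace ℝ (Fin m)) :
    EuclideanSpace ℝ (Fin m) →ₗ[ℝ] EuclideanSpace ℝ (Fin (m + 1)) :=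
  embed e - (innerₛₗ ℝ b).smulRight (e 0)

theorem graphMap_apply (b p : EuclideanSpace ℝ (Fin m)) :
    graphMap e b p = point e (-⟪b, p⟫) p := by
  simp only [graphMap, LinearMap.sub_apply, LinearMap.smulRight_apply, innerₛₗ_apply_apply,
    point_eq_smul_add_embed, neg_smul]
  abel

theorem adjoint_comp_graphMap (b : EuclideanSpace ℝ (Fin m)) :
    (graphMap e b).adjoint ∘ₗ graphMap e b = LinearMap.transvection (innerₛₗ ℝ b) b := by
  refine LinearMap.ext fun p => ext_inner_right ℝ fun q => ?_
  rw [LinearMap.comp_apply, LinearMap.adjoint_inner_left, graphMap_apply, graphMap_apply,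
    inner_point_right, inner_point, proj_point, LinearMap.transvection.apply, inner_add_left,
    innerₛₗ_apply_apply, real_inner_smul_left]
  ring

theorem normDet_graphMap (b : EuclideanSpace ℝ (Fin m)) :
    (graphMap e b).normDet = √(1 + ‖b‖ ^ 2) := by
  have h := (graphMap e b).normDet_sq
  rw [adjoint_comp_graphMap, LinearMap.transvection.det, innerₛₗ_apply_apply,
    real_inner_self_eq_norm_sq] at h
  rw [← Real.sqrt_sq (graphMap e b).normDet_nonneg]
  exact congrArg _ h

variable {v : EuclideanSpace ℝ (Fin (m + 1))}

/-- Away from the equator `⟪v, e 0⟫ = 0`, the central projection of a point `v` to the hyperplane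
`{1} × ℝ^m`; on the open hemisphere around `e 0` it is the inverse of `Phi e`. -/
def gnomonic (v : EuclideanSpace ℝ (Fin (m + 1))) : EuclideanSpace ℝ (Fin m) :=
  ⟪v, e 0⟫⁻¹ • proj e v

theorem point_one_gnomonic (hv₀ : ⟪v, e 0⟫ ≠ 0) :
    point e 1 (gnomonic e v) = ⟪v, e 0⟫⁻¹ • v := by
  rw [← point_proj e (⟪v, e 0⟫⁻¹ • v), real_inner_smul_left, inv_mul_cancel₀ hv₀, map_smul,
    gnomonic]

theorem sqrt_one_add_norm_gnomonic_sq (hv : ‖v‖ = 1) (hv₀ : 0 < ⟪v, e 0⟫) :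
    √(1 + ‖gnomonic e v‖ ^ 2) = ⟪v, e 0⟫⁻¹ := by
  rw [← norm_point_one e, point_one_gnomonic e hv₀.ne', norm_smul, hv, mul_one,
    Real.norm_of_nonneg (by positivity)]

theorem graphMap_gnomonic_proj_sub (hv₀ : ⟪v, e 0⟫ ≠ 0) (z : EuclideanSpace ℝ (Fin (m + 1))) :
    graphMap e (gnomonic e v) (proj e z) - z = -(⟪v, e 0⟫⁻¹ * ⟪z, v⟫) • e 0 := by
  refine eq_of_inner_eq_of_proj_eq e ?_ ?_
  · rw [graphMap_apply, inner_sub_left, inner_point, gnomonic, real_inner_smul_left,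
      real_inner_smul_left, e.inner_eq_one, inner_eq_coords e z v, real_inner_comm (proj e v)]
    field_simp
    ring
  · have : proj e (e 0) = 0 := by ext i; simp [e.inner_eq_ite, Fin.succ_ne_zero]
    rw [graphMap_apply, map_sub, proj_point, sub_self, map_smul, this, smul_zero]

theorem approximatesLinearOn_graphMap_gnomonic_proj {κ : NNReal}
    {A : Set (EuclideanSpace ℝ (Fin (m + 1)))} (hv₀ : 0 < ⟪v, e 0⟫)
    (hA : ∀ x ∈ A, ∀ y ∈ A, |⟪x - y, v⟫| ≤ κ * ⟪v, e 0⟫ * ‖x - y‖) :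
    ApproximatesLinearOn (fun z => graphMap e (gnomonic e v) (proj e z))
      (ContinuousLinearMap.id ℝ _) A κ := by
  intro x hx y hy
  rw [← map_sub, ← map_sub, ContinuousLinearMap.id_apply, graphMap_gnomonic_proj_sub e hv₀.ne',
    norm_smul, e.norm_eq_one, mul_one, norm_neg, Real.norm_eq_abs, abs_mul, abs_inv,
    abs_of_pos hv₀, inv_mul_le_iff₀ hv₀]
  linarith [hA x hx y hy]

theorem ofReal_inner_mul_euclideanHausdorffMeasure_graphMap_image (hv : ‖v‖ = 1)
    (hv₀ : 0 < ⟪v, e 0⟫) (S : Set (EuclideanSpace ℝ (Fin m))) :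
    ENNReal.ofReal ⟪v, e 0⟫ * μHE[m] (graphMap e (gnomonic e v) '' S) = μHE[m] S := by
  have h := (graphMap e (gnomonic e v)).euclideanHausdorffMeasure_image S
  rw [finrank_euclideanSpace_fin, normDet_graphMap, sqrt_one_add_norm_gnomonic_sq e hv hv₀] at h
  rw [h, ← mul_assoc, ← ENNReal.ofReal_mul hv₀.le, mul_inv_cancel₀ hv₀.ne', ENNReal.ofReal_one,
    one_mul]

theorem euclideanHausdorffMeasure_proj_image_le {κ : NNReal} (hv : ‖v‖ = 1) (hv₀ : 0 < ⟪v, e 0⟫)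
    {A : Set (EuclideanSpace ℝ (Fin (m + 1)))}
    (hA : ∀ x ∈ A, ∀ y ∈ A, |⟪x - y, v⟫| ≤ κ * ⟪v, e 0⟫ * ‖x - y‖) :
    μHE[m] (proj e '' A) ≤
      ((1 + κ : NNReal) : ℝ≥0∞) ^ m * (ENNReal.ofReal ⟪v, e 0⟫ * μHE[m] A) := by
  rw [← ofReal_inner_mul_euclideanHausdorffMeasure_graphMap_image e hv hv₀, Set.image_image,
    mul_left_comm]
  gcongr
  exact euclideanHausdorffMeasure_image_le_of_approximatesLinearOn_id
    (approximatesLinearOn_graphMap_gnomonic_proj e hv₀ hA) m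

theorem le_euclideanHausdorffMeasure_proj_image {κ : NNReal} (hκ : κ < 1) (hv : ‖v‖ = 1)
    (hv₀ : 0 < ⟪v, e 0⟫) {A : Set (EuclideanSpace ℝ (Fin (m + 1)))}
    (hA : ∀ x ∈ A, ∀ y ∈ A, |⟪x - y, v⟫| ≤ κ * ⟪v, e 0⟫ * ‖x - y‖) :
    ((1 - κ : NNReal) : ℝ≥0∞) ^ m * (ENNReal.ofReal ⟪v, e 0⟫ * μHE[m] A) ≤
      μHE[m] (proj e '' A) := by
  rw [← ofReal_inner_mul_euclideanHausdorffMeasure_graphMap_image e hv hv₀ (proj e '' A),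
    Set.image_image, mul_left_comm]
  gcongr
  exact le_euclideanHausdorffMeasure_image_of_approximatesLinearOn_id hκ
    (approximatesLinearOn_graphMap_gnomonic_proj e hv₀ hA) m

end GraphMap

section Face

variable {E : Type*} [NormedAddCommGroup E] [InnerProductSpace ℝ E] {K : Set E} {v w x y : E}

/-- The exposed face of `K` with outer normal `v`, that is, the support set `F(K, v)`. -/
def face (K : Set E) (v : E) : Set E :=
  {x ∈ K | ∀ y ∈ K, ⟪y, v⟫ ≤ ⟪x, v⟫}

theorem face_smul {c : ℝ} (hc : 0 < c) (K : Set E) (v : E) : face K (c • v) = face K v := by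
  simp only [face, real_inner_smul_right, mul_le_mul_iff_right₀ hc]

theorem inner_sub_nonpos_of_mem_face (hx : x ∈ face K v) (hy : y ∈ K) : ⟪y - x, v⟫ ≤ 0 := by
  rw [inner_sub_left]
  exact sub_nonpos.2 (hx.2 y hy)

theorem face_subset_frontier (hv : v ≠ 0) : face K v ⊆ frontier K := by
  refine fun x hx => ⟨subset_closure hx.1, fun hi => ?_⟩
  have hlim : Tendsto (fun t : ℝ => x + t • v) (𝓝[>] 0) (𝓝 x) := by
    have hcont : Continuous fun t : ℝ => x + t • v := by fun_prop
    simpa only [zero_smul, add_zero] using (hcont.tendsto 0).mono_left nhdsWithin_le_nhds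
  obtain ⟨t, htK, ht⟩ := ((hlim.eventually (mem_interior_iff_mem_nhds.1 hi)).and
    self_mem_nhdsWithin).exists
  have h := inner_sub_nonpos_of_mem_face hx htK
  rw [add_sub_cancel_left, real_inner_smul_left] at h
  exact (mul_pos ht (real_inner_self_pos.2 hv)).not_ge h

theorem isClosed_biUnion_face (hK : IsClosed K) {k : Set E} (hk : IsCompact k) :
    IsClosed (⋃ v ∈ k, face K v) := by
  have : CompactSpace k := isCompact_iff_compactSpace.1 hk
  have hgraph : IsClosed {p : E × k | p.1 ∈ face K p.2} := by
    have hset : {p : E × k | p.1 ∈ face K p.2} =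
        Prod.fst ⁻¹' K ∩ ⋂ y ∈ K, {p : E × k | ⟪y, (p.2 : E)⟫ ≤ ⟪p.1, (p.2 : E)⟫} := by
      ext p
      simp [face]
    rw [hset]
    exact (hK.preimage continuous_fst).inter
      (isClosed_biInter fun y _ => isClosed_le (by fun_prop) (by fun_prop))
  convert isClosedMap_fst_of_compactSpace _ hgraph
  ext x
  simp

theorem abs_inner_sub_le_of_mem_face {w' : E} {ε : ℝ} (hx : x ∈ face K w) (hy : y ∈ face K w')
    (hw : ‖v - w‖ ≤ ε) (hw' : ‖v - w'‖ ≤ ε) : |⟪x - y, v⟫| ≤ ε * ‖x - y‖ := by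
  have inner_le : ∀ {x y w : E}, x ∈ K → y ∈ face K w → ‖v - w‖ ≤ ε →
      ⟪x - y, v⟫ ≤ ε * ‖x - y‖ := fun {x y w} hx hy hw =>
    calc ⟪x - y, v⟫ = ⟪x - y, w⟫ + ⟪x - y, v - w⟫ := by rw [← inner_add_right, add_sub_cancel]
      _ ≤ 0 + ‖x - y‖ * ‖v - w‖ :=
        add_le_add (inner_sub_nonpos_of_mem_face hy hx) (real_inner_le_norm _ _)
      _ ≤ ε * ‖x - y‖ := by rw [zero_add, mul_comm]; gcongr
  refine abs_le'.2 ⟨inner_le hx.1 hy hw', ?_⟩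
  rw [← inner_neg_left, neg_sub, norm_sub_rev]
  exact inner_le hy.1 hx hw

end Face

section AreaFormula

variable {m : ℕ} (e : OrthonormalBasis (Fin (m + 1)) ℝ (EuclideanSpace ℝ (Fin (m + 1))))
  {K S : Set (EuclideanSpace ℝ (Fin (m + 1)))} {μ : Measure S}

theorem inner_le_inner_of_mem_face {v x y : EuclideanSpace ℝ (Fin (m + 1))} (hv₀ : 0 < ⟪v, e 0⟫)
    (hx : x ∈ face K v) (hy : y ∈ K) (hxy : proj e x = proj e y) : ⟪y, e 0⟫ ≤ ⟪x, e 0⟫ := by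
  have h := inner_sub_nonpos_of_mem_face hx hy
  rw [inner_eq_coords e, map_sub, hxy, sub_self, inner_zero_left, add_zero, inner_sub_left] at h
  exact sub_nonpos.1 (nonpos_of_mul_nonpos_left h hv₀)

theorem injOn_proj_biUnion_face (hS₀ : ∀ v ∈ S, 0 < ⟪v, e 0⟫) :
    Set.InjOn (proj e) (⋃ v ∈ S, face K v) := by
  intro x hx y hy hxy
  obtain ⟨v, hv, hxv⟩ := Set.mem_iUnion₂.1 hx
  obtain ⟨w, hw, hyw⟩ := Set.mem_iUnion₂.1 hy
  exact eq_of_inner_eq_of_proj_eq e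
    ((inner_le_inner_of_mem_face e (hS₀ w hw) hyw hxv.1 hxy.symm).antisymm
      (inner_le_inner_of_mem_face e (hS₀ v hv) hxv hyw.1 hxy)) hxy

theorem isClosed_biUnion_face_subtype (hK : IsClosed K) {k : Set S} (hk : IsCompact k) :
    IsClosed (⋃ v ∈ k, face K v.1) := by
  simpa only [Set.biUnion_image] using
    isClosed_biUnion_face hK (hk.image continuous_subtype_val)

theorem measurableSet_proj_image_of_isClosed {A : Set (EuclideanSpace ℝ (Fin (m + 1)))}
    (hA : IsClosed A) : MeasurableSet (proj e '' A) := by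
  obtain ⟨L, hL, hLA⟩ := (isSigmaCompact_univ.of_isClosed_subset hA (Set.subset_univ _)).image
    (proj e).continuous
  rw [← hLA]
  exact MeasurableSet.iUnion fun i => (hL i).measurableSet

theorem euclideanHausdorffMeasure_proj_image_eq_zero {A : Set (EuclideanSpace ℝ (Fin (m + 1)))}
    (hA : μHE[m] A = 0) : μHE[m] (proj e '' A) = 0 := by
  have h := euclideanHausdorffMeasure_image_le ((proj e).lipschitz.lipschitzOnWith (s := A)) m
  rw [hA, mul_zero] at h
  exact le_antisymm h zero_le

theorem exists_measure_eq_measure_biUnion_proj_face [LocallyCompactSpace S]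
    [IsLocallyFiniteMeasure μ] (hK : IsClosed K) (hS₀ : ∀ v ∈ S, 0 < ⟪v, e 0⟫)
    (hμ : ∀ η : Set S, MeasurableSet η → μHE[m] (⋃ v ∈ η, face K v.1) = μ η) :
    ∃ P : Measure S, ∀ η, MeasurableSet η → P η = μHE[m] (proj e '' ⋃ v ∈ η, face K v.1) := by
  have hclosed {k : Set S} (hk : IsCompact k) := isClosed_biUnion_face_subtype hK hk
  have hsub (k : Set S) : ⋃ v ∈ k, face K v.1 ⊆ ⋃ v ∈ S, face K v :=
    Set.iUnion₂_subset fun v _ => Set.subset_biUnion_of_mem (u := face K) v.2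
  simp only [Set.image_iUnion₂]
  refine exists_measure_eq_measure_biUnion (fun k hk => ?_) fun k l hk hl hkl => ?_
  · rw [← Set.image_iUnion₂]
    exact (measurableSet_proj_image_of_isClosed e (hclosed hk)).nullMeasurableSet
  · rw [← Set.image_iUnion₂, ← Set.image_iUnion₂, AEDisjoint,
      ← (injOn_proj_biUnion_face e hS₀).image_inter (hsub k) (hsub l)]
    exact euclideanHausdorffMeasure_proj_image_eq_zero e
      (aedisjoint_biUnion_of_measure_biUnion_eq (fun k hk => (hclosed hk).measurableSet) hμ
        hk hl hkl)

theorem setLIntegral_ofReal_inner_bounds {κ : NNReal} {v : EuclideanSpace ℝ (Fin (m + 1))}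
    {η : Set S} (hη : MeasurableSet η) (hv : ∀ w ∈ η, ‖v - w‖ ≤ κ * ⟪v, e 0⟫) :
    ((1 - κ : NNReal) : ℝ≥0∞) * (ENNReal.ofReal ⟪v, e 0⟫ * μ η) ≤
        ∫⁻ w in η, ENNReal.ofReal ⟪w.1, e 0⟫ ∂μ ∧
      ∫⁻ w in η, ENNReal.ofReal ⟪w.1, e 0⟫ ∂μ ≤
        ((1 + κ : NNReal) : ℝ≥0∞) * (ENNReal.ofReal ⟪v, e 0⟫ * μ η) := by
  have hdist : ∀ w ∈ η, |⟪v, e 0⟫ - ⟪w.1, e 0⟫| ≤ κ * ⟪v, e 0⟫ := fun w hw => by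
    rw [← inner_sub_left]
    refine (abs_real_inner_le_norm _ _).trans ?_
    rw [e.norm_eq_one, mul_one]
    exact hv w hw
  simp only [← mul_assoc, ← ENNReal.ofReal_coe_nnreal, ← ENNReal.ofReal_mul NNReal.zero_le_coe]
  rw [← setLIntegral_const, ← setLIntegral_const]
  refine ⟨setLIntegral_mono' hη fun w hw => ?_, setLIntegral_mono' hη fun w hw => ?_⟩
  · obtain hκ | hκ := le_total κ 1
    · refine ENNReal.ofReal_le_ofReal ?_
      rw [NNReal.coe_sub hκ, NNReal.coe_one]
      linarith [(abs_le.1 (hdist w hw)).2]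
    · simp [tsub_eq_zero_of_le hκ]
  · refine ENNReal.ofReal_le_ofReal ?_
    rw [NNReal.coe_add, NNReal.coe_one]
    linarith [(abs_le.1 (hdist w hw)).1]

theorem measure_proj_biUnion_face_bounds {κ : NNReal} (hκ : κ < 1) {v : S}
    (hv : ‖v.1‖ = 1) (hv₀ : 0 < ⟪v.1, e 0⟫) {η : Set S} (hη : MeasurableSet η)
    (hvη : η ⊆ Metric.closedBall v (κ * ⟪v.1, e 0⟫))
    (hμ : μHE[m] (⋃ v ∈ η, face K v.1) = μ η) :
    ((1 - κ : NNReal) : ℝ≥0∞) ^ m * ∫⁻ w in η, ENNReal.ofReal ⟪w.1, e 0⟫ ∂μ ≤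
        ((1 + κ : NNReal) : ℝ≥0∞) * μHE[m] (proj e '' ⋃ v ∈ η, face K v.1) ∧
      ((1 - κ : NNReal) : ℝ≥0∞) * μHE[m] (proj e '' ⋃ v ∈ η, face K v.1) ≤
        ((1 + κ : NNReal) : ℝ≥0∞) ^ m * ∫⁻ w in η, ENNReal.ofReal ⟪w.1, e 0⟫ ∂μ := by
  have hdist : ∀ w ∈ η, ‖v.1 - w‖ ≤ κ * ⟪v.1, e 0⟫ := fun w hw => by
    rw [← dist_eq_norm', ← Subtype.dist_eq]
    exact hvη hw
  have hchord : ∀ x ∈ ⋃ v ∈ η, face K v.1, ∀ y ∈ ⋃ v ∈ η, face K v.1,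
      |⟪x - y, v.1⟫| ≤ κ * ⟪v.1, e 0⟫ * ‖x - y‖ := by
    intro x hx y hy
    obtain ⟨w, hw, hxw⟩ := Set.mem_iUnion₂.1 hx
    obtain ⟨w', hw', hyw'⟩ := Set.mem_iUnion₂.1 hy
    exact abs_inner_sub_le_of_mem_face hxw hyw' (hdist w hw) (hdist w' hw')
  have hlower := le_euclideanHausdorffMeasure_proj_image e hκ hv hv₀ hchord
  have hupper := euclideanHausdorffMeasure_proj_image_le e hv hv₀ hchord
  obtain ⟨hle, hge⟩ := setLIntegral_ofReal_inner_bounds e (μ := μ) hη hdist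
  rw [hμ] at hlower hupper
  constructor
  · grw [hge, mul_left_comm, hlower]
  · grw [hupper, mul_left_comm, hle]

theorem measure_proj_biUnion_face [LocallyCompactSpace S] [IsLocallyFiniteMeasure μ]
    (hK : IsClosed K) (hS : ∀ v ∈ S, ‖v‖ = 1) (hS₀ : ∀ v ∈ S, 0 < ⟪v, e 0⟫)
    (hμ : ∀ η : Set S, MeasurableSet η → μHE[m] (⋃ v ∈ η, face K v.1) = μ η)
    {η : Set S} (hη : MeasurableSet η) :
    μHE[m] (proj e '' ⋃ v ∈ η, face K v.1) =
      ∫⁻ v in η, ENNReal.ofReal ⟪v.1, e 0⟫ ∂μ := by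
  obtain ⟨P, hP⟩ := exists_measure_eq_measure_biUnion_proj_face e hK hS₀ hμ
  set D := μ.withDensity fun v : S => ENNReal.ofReal ⟪v.1, e 0⟫ with hD
  have hnhds {κ : NNReal} (hκ : 0 < κ) (v : S) := Metric.closedBall_mem_nhds v
    (mul_pos (NNReal.coe_pos.2 hκ) (hS₀ v v.2))
  have hbounds {κ : NNReal} (hκ : κ < 1) (v : S) {ζ : Set S}
      (hvζ : ζ ⊆ Metric.closedBall v (κ * ⟪v.1, e 0⟫)) (hζ : MeasurableSet ζ) :
      ((1 - κ) ^ m • D) ζ ≤ ((1 + κ) • P) ζ ∧ ((1 - κ) • P) ζ ≤ ((1 + κ) ^ m • D) ζ := by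
    simpa only [Measure.smul_apply, ENNReal.smul_def, smul_eq_mul, ENNReal.coe_pow, hP ζ hζ, hD,
      withDensity_apply _ hζ] using
      measure_proj_biUnion_face_bounds e hκ (hS v v.2) (hS₀ v v.2) hζ hvζ (hμ ζ hζ)
  have hDP {κ : NNReal} (hκ₀ : 0 < κ) (hκ : κ < 1) : (1 - κ) ^ m • D ≤ (1 + κ) • P :=
    measure_le_of_forall_exists_nhds_le fun v =>
      ⟨_, hnhds hκ₀ v, fun _ hvζ hζ => (hbounds hκ v hvζ hζ).1⟩
  have hPD {κ : NNReal} (hκ₀ : 0 < κ) (hκ : κ < 1) : (1 - κ) • P ≤ (1 + κ) ^ m • D :=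
    measure_le_of_forall_exists_nhds_le fun v =>
      ⟨_, hnhds hκ₀ v, fun _ hvζ hζ => (hbounds hκ v hvζ hζ).2⟩
  rw [← hP η hη, ← withDensity_apply _ hη, ← hD]
  exact le_antisymm
    (le_of_forall_mul_le_mul (f := (1 - ·)) (g := fun κ => (1 + κ) ^ m) (by fun_prop) (by simp)
      (by fun_prop) (by simp) fun _ hκ₀ hκ => hPD hκ₀ hκ η)
    (le_of_forall_mul_le_mul (f := fun κ => (1 - κ) ^ m) (g := (1 + ·)) (by fun_prop) (by simp)
      (by fun_prop) (by simp) fun _ hκ₀ hκ => hDP hκ₀ hκ η)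

end AreaFormula

section DualCone

variable {E : Type*} [NormedAddCommGroup E] [InnerProductSpace ℝ E] {C : Set E}

theorem dualCone_eq_biInter (C : Set E) : dualCone C = ⋂ x ∈ C, {y | ⟪x, y⟫ ≤ 0} := by
  ext y
  simp [dualCone]

theorem isClosed_dualCone (C : Set E) : IsClosed (dualCone C) := by
  rw [dualCone_eq_biInter]
  exact isClosed_biInter fun x _ => isClosed_le (by fun_prop) continuous_const

theorem convex_dualCone (C : Set E) : Convex ℝ (dualCone C) := by
  rw [dualCone_eq_biInter]
  exact convex_iInter₂ fun x _ => convex_halfSpace_le (innerₗ E x).isLinear 0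

theorem smul_mem_dualCone {y : E} (hy : y ∈ dualCone C) {r : ℝ} (hr : 0 ≤ r) :
    r • y ∈ dualCone C := fun x hx => by
  rw [real_inner_smul_right]
  exact mul_nonpos_of_nonneg_of_nonpos hr (hy x hx)

open scoped Pointwise in
theorem smul_mem_interior_dualCone_iff {y : E} {r : ℝ} (hr : 0 < r) :
    r • y ∈ interior (dualCone C) ↔ y ∈ interior (dualCone C) := by
  have hset : r • dualCone C = dualCone C := by
    ext z
    rw [Set.mem_smul_set_iff_inv_smul_mem₀ hr.ne']
    refine ⟨fun h => ?_, fun h => smul_mem_dualCone h (by positivity)⟩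
    simpa only [smul_inv_smul₀ hr.ne'] using smul_mem_dualCone h hr.le
  conv_lhs => rw [← hset, interior_smul₀ hr.ne']
  exact Set.smul_mem_smul_set_iff₀ hr.ne' _ _

theorem inner_neg_of_mem_interior {u v : E} (hu : u ∈ interior C) (hv : v ∈ dualCone C)
    (hv₀ : v ≠ 0) : ⟪u, v⟫ < 0 := by
  by_contra! h
  have huf : u ∈ face C v := ⟨interior_subset hu, fun y hy => (hv y hy).trans h⟩
  exact disjoint_interior_frontier.le_bot ⟨hu, face_subset_frontier hv₀ huf⟩

end DualCone

section SupportFunction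

variable {E : Type*} [NormedAddCommGroup E] [InnerProductSpace ℝ E] {C K : Set E} {v x y : E}

theorem supportFunction_smul (K : Set E) {c : ℝ} (hc : 0 ≤ c) (v : E) :
    supportFunction K (c • v) = c * supportFunction K v := by
  rw [supportFunction, supportFunction, ← smul_eq_mul, ← Real.sSup_smul_of_nonneg hc,
    ← Set.image_smul, Set.image_image]
  simp only [real_inner_smul_right, smul_eq_mul]

theorem supportFunction_le (hK : K.Nonempty) {a : ℝ} (h : ∀ x ∈ K, ⟪x, v⟫ ≤ a) :
    supportFunction K v ≤ a :=
  csSup_le (hK.image _) (Set.forall_mem_image.2 h)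

theorem IsCPseudo.subset (hK : IsCPseudo C K) : K ⊆ C := by
  intro y hy
  rw [← hK.2]
  intro x hx r hr
  have hr' : 0 < 1 + r := by linarith
  have h := hK.1.smul_mem _ (hK.1.convex hx hy (a := 1 / (1 + r)) (b := r / (1 + r))
    (by positivity) (by positivity) (by field_simp)) (1 + r) (by linarith)
  rwa [smul_add, smul_smul, smul_smul, mul_div_cancel₀ _ hr'.ne', mul_div_cancel₀ _ hr'.ne',
    one_smul] at h

theorem IsCPseudo.add_mem (hK : IsCPseudo C K) (hx : x ∈ K) (hy : y ∈ C) : x + y ∈ K := by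
  rw [← hK.2] at hy
  simpa only [one_smul] using hy x hx 1 le_rfl

theorem IsCPseudo.inner_le_supportFunction (hK : IsCPseudo C K) (hv : v ∈ dualCone C)
    (hx : x ∈ K) : ⟪x, v⟫ ≤ supportFunction K v :=
  le_csSup ⟨0, Set.forall_mem_image.2 fun y hy => hv y (hK.subset hy)⟩ ⟨x, hx, rfl⟩

theorem IsCPseudo.supportFunction_nonpos (hK : IsCPseudo C K) (hv : v ∈ dualCone C) :
    supportFunction K v ≤ 0 :=
  supportFunction_le hK.1.nonempty fun x hx => hv x (hK.subset hx)

theorem IsCPseudo.mem_face_iff (hK : IsCPseudo C K) (hv : v ∈ dualCone C) :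
    x ∈ face K v ↔ x ∈ K ∧ ⟪x, v⟫ = supportFunction K v :=
  and_congr_right fun hx =>
    ⟨fun h => (hK.inner_le_supportFunction hv hx).antisymm (supportFunction_le hK.1.nonempty h),
      fun h _ hy => h ▸ hK.inner_le_supportFunction hv hy⟩

theorem IsCPseudo.inverseGaussImage_eq_biUnion_face (hK : IsCPseudo C K) {η : Set E}
    (hη : η ⊆ dualCone C) (hη₀ : 0 ∉ η) : inverseGaussImage K η = ⋃ v ∈ η, face K v := by
  ext x
  simp only [Set.mem_iUnion₂]
  constructor
  · rintro ⟨hx, v, hv, hxv⟩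
    exact ⟨v, hv, (hK.mem_face_iff (hη hv)).2 ⟨hK.1.isClosed.frontier_subset hx, hxv⟩⟩
  · rintro ⟨v, hv, hxv⟩
    exact ⟨face_subset_frontier (ne_of_mem_of_not_mem hv hη₀) hxv, v, hv,
      ((hK.mem_face_iff (hη hv)).1 hxv).2⟩

theorem IsCPseudo.convexOn_supportFunction (hK : IsCPseudo C K) :
    ConvexOn ℝ (dualCone C) (supportFunction K) := by
  refine ⟨convex_dualCone C, fun v hv w hw a b ha hb _ =>
    supportFunction_le hK.1.nonempty fun x hx => ?_⟩
  rw [inner_add_right, real_inner_smul_right, real_inner_smul_right]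
  exact add_le_add (mul_le_mul_of_nonneg_left (hK.inner_le_supportFunction hv hx) ha)
    (mul_le_mul_of_nonneg_left (hK.inner_le_supportFunction hw hx) hb)

theorem IsCPseudo.mem_dualCone_of_forall_inner_le (hK : IsCPseudo C K) {a : ℝ}
    (h : ∀ x ∈ K, ⟪x, v⟫ ≤ a) : v ∈ dualCone C := by
  intro c hc
  rw [← hK.2] at hc
  obtain ⟨x, hx⟩ := hK.1.nonempty
  by_contra! hcv
  have hlim : Tendsto (fun r : ℝ => ⟪x, v⟫ + r * ⟪c, v⟫) atTop atTop :=
    tendsto_atTop_add_const_left _ _ (tendsto_id.atTop_mul_const hcv)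
  obtain ⟨r, hr, har⟩ := ((eventually_ge_atTop 1).and (hlim.eventually_gt_atTop a)).exists
  rw [← real_inner_smul_left, ← inner_add_left] at har
  exact har.not_ge (h _ (hc x hx r hr))

theorem IsCPseudo.mem_of_forall_inner_le [CompleteSpace E] (hK : IsCPseudo C K)
    (h : ∀ v ∈ dualCone C, v ≠ 0 → ⟪x, v⟫ ≤ supportFunction K v) : x ∈ K := by
  by_contra hx
  obtain ⟨f, a, hfK, hfx⟩ := geometric_hahn_banach_closed_point hK.1.convex hK.1.isClosed hx
  obtain ⟨v, rfl⟩ := (InnerProductSpace.toDual ℝ E).surjective f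
  simp only [InnerProductSpace.toDual_apply_apply, real_inner_comm _ v] at hfK hfx
  have hle : ∀ y ∈ K, ⟪y, v⟫ ≤ a := fun y hy => (hfK y hy).le
  have hv₀ : v ≠ 0 := by
    rintro rfl
    obtain ⟨y, hy⟩ := hK.1.nonempty
    have hlt := (hfK y hy).trans hfx
    rw [inner_zero_right, inner_zero_right] at hlt
    exact lt_irrefl _ hlt
  exact hfx.not_ge ((h v (hK.mem_dualCone_of_forall_inner_le hle) hv₀).trans
    (supportFunction_le hK.1.nonempty hle))

end SupportFunction

section GnomonicChart

variable {m : ℕ} (e : OrthonormalBasis (Fin (m + 1)) ℝ (EuclideanSpace ℝ (Fin (m + 1))))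
  {C : Set (EuclideanSpace ℝ (Fin (m + 1)))}

/-- The parametrization `x ↦ (1, x)` of the affine hyperplane `{1} × ℝ^m` as an affine map; it
makes convexity on `ℝ^m` a matter of pulling back. -/
def affineChart : EuclideanSpace ℝ (Fin m) →ᵃ[ℝ] EuclideanSpace ℝ (Fin (m + 1)) :=
  (embed e).toAffineMap + AffineMap.const ℝ _ (e 0)

theorem coe_affineChart : ⇑(affineChart e) = point e 1 := by
  ext1 x
  rw [point_eq_smul_add_embed, one_smul]
  exact add_comm _ _

theorem continuous_point_one : Continuous (point e 1) := by
  rw [← coe_affineChart]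
  exact (affineChart e).continuous_of_finiteDimensional

theorem norm_Phi (x : EuclideanSpace ℝ (Fin m)) : ‖Phi e x‖ = 1 := by
  have hpos : 0 < √(1 + ‖x‖ ^ 2) := by positivity
  rw [Phi, norm_smul, norm_point_one, norm_inv, Real.norm_of_nonneg hpos.le,
    inv_mul_cancel₀ hpos.ne']

theorem Phi_gnomonic {v : EuclideanSpace ℝ (Fin (m + 1))} (hv : ‖v‖ = 1) (hv₀ : 0 < ⟪v, e 0⟫) :
    Phi e (gnomonic e v) = v := by
  rw [Phi, point_one_gnomonic e hv₀.ne', sqrt_one_add_norm_gnomonic_sq e hv hv₀, inv_inv,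
    smul_inv_smul₀ hv₀.ne']

theorem gnomonic_Phi (x : EuclideanSpace ℝ (Fin m)) : gnomonic e (Phi e x) = x := by
  have hpos : 0 < √(1 + ‖x‖ ^ 2) := by positivity
  rw [gnomonic, Phi, real_inner_smul_left, map_smul, inner_point, proj_point, mul_one, inv_inv,
    smul_inv_smul₀ hpos.ne']

theorem PhiDomain_eq_preimage : PhiDomain C e = point e 1 ⁻¹' interior (dualCone C) := by
  ext x
  have hpos : 0 < (√(1 + ‖x‖ ^ 2))⁻¹ := by positivity
  refine ⟨fun h => (smul_mem_interior_dualCone_iff hpos).1 h.1, fun h =>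
    ⟨(smul_mem_interior_dualCone_iff hpos).2 h, mem_sphere_zero_iff_norm.2 (norm_Phi e x)⟩⟩

theorem isOpen_PhiDomain : IsOpen (PhiDomain C e) := by
  rw [PhiDomain_eq_preimage]
  exact isOpen_interior.preimage (continuous_point_one e)

theorem convex_PhiDomain : Convex ℝ (PhiDomain C e) := by
  rw [PhiDomain_eq_preimage, ← coe_affineChart]
  exact (convex_dualCone C).interior.affine_preimage _

theorem closure_PhiDomain_subset : closure (PhiDomain C e) ⊆ point e 1 ⁻¹' dualCone C := by
  rw [PhiDomain_eq_preimage]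
  exact closure_minimal (Set.preimage_mono interior_subset)
    ((isClosed_dualCone C).preimage (continuous_point_one e))

theorem mem_closure_PhiDomain (hne : (PhiDomain C e).Nonempty) {y : EuclideanSpace ℝ (Fin m)}
    (hy : point e 1 y ∈ dualCone C) : y ∈ closure (PhiDomain C e) := by
  obtain ⟨x, hx⟩ := hne
  have hsegment : openSegment ℝ x y ⊆ PhiDomain C e := by
    rw [PhiDomain_eq_preimage] at hx ⊢
    rw [← Set.image_subset_iff, ← coe_affineChart, image_openSegment, coe_affineChart]
    exact (convex_dualCone C).openSegment_interior_self_subset_interior hx hy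
  exact closure_mono hsegment (segment_subset_closure_openSegment (right_mem_segment ℝ x y))

theorem measurableSet_mem_Phi_image (hC : ∀ v ∈ Omega C, 0 < ⟪v, e 0⟫)
    {η : Set (EuclideanSpace ℝ (Fin m))} (hη : MeasurableSet η) :
    MeasurableSet {v : Omega C | v.1 ∈ Phi e '' η} := by
  have hpreimage : {v : Omega C | v.1 ∈ Phi e '' η} = (fun v => gnomonic e v.1) ⁻¹' η := by
    ext v
    constructor
    · rintro ⟨x, hx, hxv⟩
      rwa [Set.mem_preimage, ← hxv, gnomonic_Phi]
    · exact fun h => ⟨_, h, Phi_gnomonic e (mem_sphere_zero_iff_norm.1 v.2.2) (hC v v.2)⟩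
  have hcont : Continuous fun v : Omega C => gnomonic e v.1 := by
    have hinner : Continuous fun v : Omega C => ⟪v.1, e 0⟫ := by fun_prop
    exact (hinner.inv₀ fun v => (hC v v.2).ne').smul
      ((proj e).continuous.comp continuous_subtype_val)
  rw [hpreimage]
  exact hcont.measurable hη

end GnomonicChart

section Subdifferential

variable {m : ℕ} (e : OrthonormalBasis (Fin (m + 1)) ℝ (EuclideanSpace ℝ (Fin (m + 1))))
  {C K : Set (EuclideanSpace ℝ (Fin (m + 1)))} {x p : EuclideanSpace ℝ (Fin m)}

theorem IsCPseudo.convexOn_uFun (hK : IsCPseudo C K) :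
    ConvexOn ℝ (closure (PhiDomain C e)) (uFun e K) := by
  have h := hK.convexOn_supportFunction.comp_affineMap (affineChart e)
  rw [coe_affineChart] at h
  exact h.subset (closure_PhiDomain_subset e) (convex_PhiDomain e).closure

theorem IsCPseudo.continuousOn_uFun (hK : IsCPseudo C K)
    (h₀ : ∀ x ∈ frontier (PhiDomain C e), uFun e K x = 0) :
    ContinuousOn (uFun e K) (closure (PhiDomain C e)) := by
  intro x hx
  by_cases hxD : x ∈ PhiDomain C e
  · have hcont := ((hK.convexOn_uFun e).subset subset_closure (convex_PhiDomain e)).continuousOn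
      (isOpen_PhiDomain e)
    exact (hcont.continuousAt ((isOpen_PhiDomain e).mem_nhds hxD)).continuousWithinAt
  · have hux : uFun e K x = 0 := h₀ x ⟨hx, by rwa [(isOpen_PhiDomain e).interior_eq]⟩
    refine tendsto_order.2 ⟨fun a ha => ?_, fun a ha => ?_⟩
    · obtain ⟨_, ⟨z, hz, rfl⟩, haz⟩ := exists_lt_of_lt_csSup (hK.1.nonempty.image _) ha
      have hcont : Continuous fun y => ⟪z, point e 1 y⟫ :=
        continuous_const.inner (continuous_point_one e)
      filter_upwards [self_mem_nhdsWithin,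
        nhdsWithin_le_nhds ((hcont.tendsto x).eventually (lt_mem_nhds haz))] with y hy hay
      exact hay.trans_le (hK.inner_le_supportFunction (closure_PhiDomain_subset e hy) hz)
    · filter_upwards [self_mem_nhdsWithin] with y hy
      exact (hK.supportFunction_nonpos (closure_PhiDomain_subset e hy)).trans_lt (hux ▸ ha)

theorem IsCPseudo.mem_subdifferential_uFun_iff (hK : IsCPseudo C K)
    (hC : ∀ v ∈ dualCone C, v ≠ 0 → 0 < ⟪v, e 0⟫) (hx : x ∈ PhiDomain C e) :
    p ∈ subdifferential (closure (PhiDomain C e)) (uFun e K) x ↔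
      point e (uFun e K x - ⟪p, x⟫) p ∈ K := by
  have hinner (y : EuclideanSpace ℝ (Fin m)) :
      ⟪point e (uFun e K x - ⟪p, x⟫) p, point e 1 y⟫ = uFun e K x + ⟪p, y - x⟫ := by
    rw [inner_point_right, inner_point, proj_point, inner_sub_right]
    ring
  constructor
  · refine fun hp => hK.mem_of_forall_inner_le fun v hv hv₀ => ?_
    have hve : 0 < ⟪v, e 0⟫⁻¹ := inv_pos.2 (hC v hv hv₀)
    have hpoint := point_one_gnomonic e (hC v hv hv₀).ne'
    have hmem : gnomonic e v ∈ closure (PhiDomain C e) :=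
      mem_closure_PhiDomain e ⟨x, hx⟩ (hpoint ▸ smul_mem_dualCone hv hve.le)
    have hle := hp _ hmem
    rw [← hinner, uFun.eq_def e K (gnomonic e v), hpoint, real_inner_smul_right,
      supportFunction_smul K hve.le] at hle
    exact le_of_mul_le_mul_left hle hve
  · intro hpK y hy
    rw [← hinner]
    exact hK.inner_le_supportFunction (closure_PhiDomain_subset e hy) hpK

theorem IsCPseudo.subdifferential_uFun (hK : IsCPseudo C K)
    (hC : ∀ v ∈ dualCone C, v ≠ 0 → 0 < ⟪v, e 0⟫) (hx : x ∈ PhiDomain C e) :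
    subdifferential (closure (PhiDomain C e)) (uFun e K) x = proj e '' face K (Phi e x) := by
  have hxC : point e 1 x ∈ dualCone C := closure_PhiDomain_subset e (subset_closure hx)
  rw [Phi, face_smul (by positivity)]
  ext p
  rw [hK.mem_subdifferential_uFun_iff e hC hx]
  constructor
  · refine fun hpK => ⟨_, (hK.mem_face_iff hxC).2 ⟨hpK, ?_⟩, proj_point e _ p⟩
    rw [inner_point_right, inner_point, proj_point, mul_one, sub_add_cancel, uFun]
  · rintro ⟨z, hz, rfl⟩
    obtain ⟨hzK, hzx⟩ := (hK.mem_face_iff hxC).1 hz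
    rw [inner_point_right, mul_one] at hzx
    rwa [uFun, ← hzx, add_sub_cancel_right, point_proj]

theorem IsCPseudo.biUnion_subdifferential_uFun (hK : IsCPseudo C K)
    (hC : ∀ v ∈ dualCone C, v ≠ 0 → 0 < ⟪v, e 0⟫) {η : Set (EuclideanSpace ℝ (Fin m))}
    (hη : η ⊆ PhiDomain C e) :
    ⋃ x ∈ η, subdifferential (closure (PhiDomain C e)) (uFun e K) x =
      proj e '' ⋃ v ∈ {v : Omega C | v.1 ∈ Phi e '' η}, face K v.1 := by
  have himage : Subtype.val '' {v : Omega C | v.1 ∈ Phi e '' η} = Phi e '' η := by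
    rw [← Set.preimage_ofPred_eq, Set.ofPred_mem_eq, Subtype.image_preimage_coe]
    exact Set.inter_eq_right.2 (Set.image_subset_iff.2 hη)
  rw [← Set.biUnion_image (g := face K), himage, Set.biUnion_image, Set.image_iUnion₂]
  exact Set.iUnion₂_congr fun x hx => hK.subdifferential_uFun e hC (hη hx)

end Subdifferential

section FrontierCrossing

variable {E : Type*} [NormedAddCommGroup E] [NormedSpace ℝ E] {C : ProperCone ℝ E}
  {K : Set E} {u w x : E} {s ρ : ℝ}

theorem inter_frontier_nonempty_of_isPreconnected {X : Type*} [TopologicalSpace X] {s t : Set X}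
    (hs : IsPreconnected s) (ht : (s ∩ t).Nonempty) (ht' : (s ∩ tᶜ).Nonempty) :
    (s ∩ frontier t).Nonempty := by
  by_contra! hempty
  have hcover : s ⊆ interior t ∪ interior tᶜ := fun x hx => by
    by_contra hx'
    rw [Set.mem_union, not_or] at hx'
    refine hempty.subset ⟨hx, ?_⟩
    rwa [frontier_eq_inter_compl_interior]
  obtain ⟨x, -, hx, hx'⟩ := hs _ _ isOpen_interior isOpen_interior hcover
    (ht.mono fun x hx => ⟨hx.1, (hcover hx.1).resolve_right fun h => interior_subset h hx.2⟩)
    (ht'.mono fun x hx => ⟨hx.1, (hcover hx.1).resolve_left fun h => hx.2 (interior_subset h)⟩)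
  exact interior_subset hx' (interior_subset hx)

theorem exists_add_smul_mem_frontier (hK : IsClosed K) (hx : x ∉ K) (hs : 0 ≤ s)
    (hxs : x + s • u ∈ K) : ∃ t ∈ Set.Ioc 0 s, x + t • u ∈ frontier K := by
  have hray : IsPreconnected ((fun t : ℝ => x + t • u) '' Set.Icc 0 s) :=
    isPreconnected_Icc.image _ (by fun_prop)
  obtain ⟨_, ⟨t, ht, rfl⟩, htK⟩ := inter_frontier_nonempty_of_isPreconnected hray
    ⟨_, ⟨s, Set.right_mem_Icc.2 hs, rfl⟩, hxs⟩ ⟨x, ⟨0, Set.left_mem_Icc.2 hs, by simp⟩, hx⟩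
  refine ⟨t, ⟨ht.1.lt_of_ne ?_, ht.2⟩, htK⟩
  rintro rfl
  exact hx (by simpa using hK.frontier_subset htK)

theorem mul_le_infDist_frontier (hu : Metric.ball u ρ ⊆ C) (hw : w ∈ C) (hs : 0 < s)
    (hne : (frontier (C : Set E)).Nonempty) :
    s * ρ ≤ Metric.infDist (w + s • u) (frontier (C : Set E)) := by
  have hball : Metric.ball (w + s • u) (s * ρ) ⊆ C := by
    intro z hz
    have hzu : s⁻¹ • (z - w) ∈ Metric.ball u ρ := by
      rw [mem_ball_iff_norm, ← sub_sub, ← inv_mul_lt_iff₀ hs] at hz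
      rwa [mem_ball_iff_norm, ← inv_smul_smul₀ hs.ne' u, ← smul_sub, norm_smul, norm_inv,
        Real.norm_of_nonneg hs.le]
    have hmem := C.add_mem hw (C.smul_mem (hu hzu) hs.le)
    rwa [smul_inv_smul₀ hs.ne', add_sub_cancel] at hmem
  refine (Metric.le_infDist hne).2 fun y hy => ?_
  by_contra! hlt
  exact hy.2 (interior_maximal hball Metric.isOpen_ball (Metric.mem_ball'.2 hlt))

end FrontierCrossing

section Boundary

variable {E : Type*} [NormedAddCommGroup E] [InnerProductSpace ℝ E] {C : ProperCone ℝ E}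
  {K : Set E} {u v w x : E} {r : ℝ}

theorem mem_interior_dualCone_of_forall_inner_le (hr : 0 < r)
    (h : ∀ x ∈ C, ⟪x, v⟫ ≤ -r * ‖x‖) : v ∈ interior (dualCone (C : Set E)) := by
  refine mem_interior_iff_mem_nhds.2
    (mem_of_superset (Metric.closedBall_mem_nhds v hr) fun y hy x hx => ?_)
  have hyv : ⟪x, y - v⟫ ≤ ‖x‖ * r :=
    (real_inner_le_norm _ _).trans
      (mul_le_mul_of_nonneg_left (mem_closedBall_iff_norm.1 hy) (norm_nonneg x))
  rw [inner_sub_right] at hyv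
  linarith [h x hx]

theorem exists_inner_eq_zero_of_notMem_interior_dualCone [FiniteDimensional ℝ E]
    (hu : u ∈ C) (hu₀ : u ≠ 0) (hv : v ∈ dualCone (C : Set E))
    (hvi : v ∉ interior (dualCone (C : Set E))) : ∃ w ∈ C, ‖w‖ = 1 ∧ ⟪w, v⟫ = 0 := by
  have hnormalize {x : E} (hx : x ∈ C) (hx₀ : x ≠ 0) :
      ‖x‖⁻¹ • x ∈ (C : Set E) ∩ Metric.sphere 0 1 :=
    ⟨C.smul_mem hx (inv_nonneg.2 (norm_nonneg x)),
      mem_sphere_zero_iff_norm.2 (norm_smul_inv_norm (𝕜 := ℝ) hx₀)⟩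
  have hcompact : IsCompact ((C : Set E) ∩ Metric.sphere 0 1) :=
    (isCompact_sphere (0 : E) 1).inter_left C.isClosed
  obtain ⟨w, ⟨hwC, hw⟩, hmax⟩ := hcompact.exists_isMaxOn ⟨_, hnormalize hu hu₀⟩
    (f := fun w => ⟪w, v⟫) (by fun_prop)
  refine ⟨w, hwC, mem_sphere_zero_iff_norm.1 hw, (hv w hwC).eq_of_not_lt fun hneg => hvi ?_⟩
  refine mem_interior_dualCone_of_forall_inner_le (neg_pos.2 hneg) fun x hx => ?_
  rcases eq_or_ne x 0 with rfl | hx₀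
  · simp
  · have hle : ⟪‖x‖⁻¹ • x, v⟫ ≤ ⟪w, v⟫ := hmax (hnormalize hx hx₀)
    rwa [real_inner_smul_left, inv_mul_le_iff₀ (norm_pos_iff.2 hx₀), mul_comm,
      ← neg_neg ⟪w, v⟫] at hle

theorem IsCPseudo.exists_forall_add_smul_mem (hK : IsCPseudo (C : Set E) K)
    (hu : u ∈ interior (C : Set E)) : ∃ s : ℝ, 0 < s ∧ ∀ w ∈ C, w + s • u ∈ K := by
  obtain ⟨y, hy⟩ := hK.1.nonempty
  have hlim : Tendsto (fun t : ℝ => u - t • y) (𝓝[>] 0) (𝓝 u) := by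
    have hcont : Continuous fun t : ℝ => u - t • y := by fun_prop
    simpa only [zero_smul, sub_zero] using (hcont.tendsto 0).mono_left nhdsWithin_le_nhds
  obtain ⟨t, ht, htC⟩ : ∃ t : ℝ, 0 < t ∧ u - t • y ∈ C :=
    ((eventually_mem_nhdsWithin (s := Set.Ioi 0)).and
      (hlim.eventually (mem_interior_iff_mem_nhds.1 hu))).exists
  refine ⟨t⁻¹, inv_pos.2 ht, fun w hw => ?_⟩
  have hmem := hK.add_mem hy (C.add_mem hw (C.smul_mem htC (inv_pos.2 ht).le))
  rwa [smul_sub, inv_smul_smul₀ ht.ne', add_sub_assoc', add_sub_cancel] at hmem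

theorem IsCAsymptotic.exists_inner_gt (hK : IsCAsymptotic (C : Set E) K)
    (hu : u ∈ interior (C : Set E)) (hwC : w ∈ C) (hw : ‖w‖ = 1) (hv₀ : v ≠ 0)
    (hv : v ∈ dualCone (C : Set E)) (hwv : ⟪w, v⟫ = 0) {ε : ℝ} (hε : 0 < ε) :
    ∃ x ∈ K, -ε < ⟪x, v⟫ := by
  have hwf : w ∈ frontier (C : Set E) :=
    face_subset_frontier hv₀ ⟨hwC, fun y hy => hwv ▸ hv y hy⟩
  have huv : 0 < -⟪u, v⟫ := neg_pos.2 (inner_neg_of_mem_interior hu hv hv₀)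
  obtain ⟨ρ, hρ, hball⟩ := Metric.mem_nhds_iff.1 (mem_interior_iff_mem_nhds.1 hu)
  obtain ⟨s, hs, hsK⟩ := hK.1.exists_forall_add_smul_mem hu
  have hdist := hK.2.eventually (gt_mem_nhds (show 0 < ε / -⟪u, v⟫ * ρ by positivity))
  rw [eventually_inf_principal, hasBasis_cobounded_norm.eventually_iff] at hdist
  obtain ⟨R, -, hR⟩ := hdist
  set r := |R| + s * ‖u‖
  have hr : 0 ≤ r := by positivity
  have hrC : r • w ∈ C := C.smul_mem hwC hr
  by_cases hrK : r • w ∈ K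
  · exact ⟨_, hrK, by rwa [real_inner_smul_left, hwv, mul_zero, neg_lt_zero]⟩
  obtain ⟨t, ht, htK⟩ := exists_add_smul_mem_frontier hK.1.1.isClosed hrK hs.le (hsK _ hrC)
  have hnorm : R ≤ ‖r • w + t • u‖ := by
    have htri := norm_sub_le_norm_add (r • w) (t • u)
    rw [norm_smul, norm_smul, hw, mul_one, Real.norm_of_nonneg hr,
      Real.norm_of_nonneg ht.1.le] at htri
    have htu := mul_le_mul_of_nonneg_right ht.2 (norm_nonneg u)
    linarith [le_abs_self R]
  have hlt := (mul_le_infDist_frontier hball hrC ht.1 ⟨w, hwf⟩).trans_lt (hR hnorm htK)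
  refine ⟨_, hK.1.1.isClosed.frontier_subset htK, ?_⟩
  rw [inner_add_left, real_inner_smul_left, real_inner_smul_left, hwv, mul_zero, zero_add,
    neg_lt, ← mul_neg]
  exact (lt_div_iff₀ huv).1 (lt_of_mul_lt_mul_right hlt hρ.le)

theorem IsCAsymptotic.supportFunction_eq_zero [FiniteDimensional ℝ E]
    (hK : IsCAsymptotic (C : Set E) K) (hu : u ∈ interior (C : Set E)) (hv₀ : v ≠ 0)
    (hv : v ∈ dualCone (C : Set E)) (hvi : v ∉ interior (dualCone (C : Set E))) :
    supportFunction K v = 0 := by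
  have hu₀ : u ≠ 0 := by
    rintro rfl
    exact (inner_neg_of_mem_interior hu hv hv₀).ne (inner_zero_left v)
  obtain ⟨w, hwC, hw, hwv⟩ :=
    exists_inner_eq_zero_of_notMem_interior_dualCone (interior_subset hu) hu₀ hv hvi
  refine (hK.1.supportFunction_nonpos hv).antisymm (le_of_forall_pos_lt_add fun ε hε => ?_)
  obtain ⟨x, hx, hxv⟩ := hK.exists_inner_gt hu hwC hw hv₀ hv hwv hε
  linarith [hK.1.inner_le_supportFunction hv hx]

theorem IsCAsymptotic.uFun_eq_zero {m : ℕ} {C : ProperCone ℝ (EuclideanSpace ℝ (Fin (m + 1)))}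
    {K : Set (EuclideanSpace ℝ (Fin (m + 1)))} (hK : IsCAsymptotic (C : Set _) K)
    (e : OrthonormalBasis (Fin (m + 1)) ℝ (EuclideanSpace ℝ (Fin (m + 1))))
    (he : -e 0 ∈ interior (C : Set _)) {x : EuclideanSpace ℝ (Fin m)}
    (hx : x ∈ frontier (PhiDomain (C : Set _) e)) : uFun e K x = 0 := by
  have hxi : x ∉ PhiDomain (C : Set _) e := (isOpen_PhiDomain e).interior_eq ▸ hx.2
  rw [PhiDomain_eq_preimage] at hxi
  refine hK.supportFunction_eq_zero he (fun h₀ => ?_) (closure_PhiDomain_subset e hx.1) hxi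
  have hinner := inner_point e 1 x
  rw [h₀, inner_zero_left] at hinner
  exact zero_ne_one hinner

end Boundary

section MongeAmpere

variable {m : ℕ} {C K : Set (EuclideanSpace ℝ (Fin (m + 1)))}
  (e : OrthonormalBasis (Fin (m + 1)) ℝ (EuclideanSpace ℝ (Fin (m + 1))))

theorem inner_pos_of_neg_mem_interior (he : -e 0 ∈ interior C)
    {v : EuclideanSpace ℝ (Fin (m + 1))} (hv : v ∈ dualCone C) (hv₀ : v ≠ 0) : 0 < ⟪v, e 0⟫ := by
  have h := inner_neg_of_mem_interior he hv hv₀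
  rwa [inner_neg_left, neg_lt_zero, real_inner_comm] at h

theorem IsCPseudo.mongeAmpere_uFun (hK : IsCPseudo C K) (he : -e 0 ∈ interior C)
    (μ : Measure (Omega C)) [IsLocallyFiniteMeasure μ]
    (hS : ∀ η : Set (Omega C), MeasurableSet η → surfaceArea m K (Subtype.val '' η) = μ η)
    {η : Set (EuclideanSpace ℝ (Fin m))} (hη : η ⊆ PhiDomain C e) (hηm : MeasurableSet η) :
    mongeAmpere (closure (PhiDomain C e)) (uFun e K) η = muTilde e μ η := by
  have hdual : ∀ v ∈ dualCone C, v ≠ 0 → 0 < ⟪v, e 0⟫ := fun v =>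
    inner_pos_of_neg_mem_interior e he
  have hnorm : ∀ v ∈ Omega C, ‖v‖ = 1 := fun v hv => mem_sphere_zero_iff_norm.1 hv.2
  have hne : ∀ v ∈ Omega C, v ≠ 0 := fun v hv => ne_zero_of_norm_ne_zero (by simp [hnorm v hv])
  have hinner : ∀ v ∈ Omega C, 0 < ⟪v, e 0⟫ := fun v hv =>
    hdual v (interior_subset hv.1) (hne v hv)
  have hface : ∀ η : Set (Omega C), MeasurableSet η → μHE[m] (⋃ v ∈ η, face K v.1) = μ η := by
    intro η hη
    have himage : Subtype.val '' η ⊆ Omega C := Subtype.coe_image_subset _ _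
    rw [← hS η hη, surfaceArea, hK.inverseGaussImage_eq_biUnion_face
      (himage.trans fun v hv => interior_subset hv.1) (fun h => hne 0 (himage h) rfl),
      Set.biUnion_image]
  have : LocallyCompactSpace (Omega C) :=
    (isOpen_interior.isLocallyClosed.inter
      Metric.isClosed_sphere.isLocallyClosed).locallyCompactSpace
  rw [mongeAmpere, hK.biUnion_subdifferential_uFun e hdual hη, muTilde,
    measure_proj_biUnion_face e hK.1.isClosed hnorm hinner hface
      (measurableSet_mem_Phi_image e hinner hηm)]
  simp only [abs_of_pos (hinner _ (Subtype.prop _))]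

end MongeAmpere

end PseudoCone

end

theorem theorem3p4_general (m : ℕ)
    (C : ProperCone ℝ (EuclideanSpace ℝ (Fin (m + 1))))
    (e : OrthonormalBasis (Fin (m + 1)) ℝ (EuclideanSpace ℝ (Fin (m + 1))))
    (he : -e 0 ∈ interior (C : Set (EuclideanSpace ℝ (Fin (m + 1)))))
    (μ : Measure (Omega (C : Set (EuclideanSpace ℝ (Fin (m + 1))))))
    [IsLocallyFiniteMeasure μ]
    (K : Set (EuclideanSpace ℝ (Fin (m + 1))))
    (hK : IsCAsymptotic (C : Set (EuclideanSpace ℝ (Fin (m + 1)))) K)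
    (hS : ∀ η : Set (Omega (C : Set (EuclideanSpace ℝ (Fin (m + 1))))), MeasurableSet η →
      surfaceArea m K (Subtype.val '' η) = μ η) :
    ConvexOn ℝ (closure (PhiDomain (C : Set (EuclideanSpace ℝ (Fin (m + 1)))) e)) (uFun e K) ∧
    ContinuousOn (uFun e K) (closure (PhiDomain (C : Set (EuclideanSpace ℝ (Fin (m + 1)))) e)) ∧
    (∀ η ⊆ PhiDomain (C : Set (EuclideanSpace ℝ (Fin (m + 1)))) e, MeasurableSet η →
      mongeAmpere (closure (PhiDomain (C : Set (EuclideanSpace ℝ (Fin (m + 1)))) e))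
        (uFun e K) η = muTilde e μ η) ∧
    (∀ x ∈ frontier (PhiDomain (C : Set (EuclideanSpace ℝ (Fin (m + 1)))) e), uFun e K x = 0) :=
  have hzero : ∀ x ∈ frontier (PhiDomain (C : Set (EuclideanSpace ℝ (Fin (m + 1)))) e),
      uFun e K x = 0 := fun _ hx => hK.uFun_eq_zero e he hx
  ⟨hK.1.convexOn_uFun e, hK.1.continuousOn_uFun e hzero,
    fun _ hη hηm => hK.1.mongeAmpere_uFun e he μ hS hη hηm, hzero⟩

theorem theorem3p4 (m : ℕ)
    (C : ProperCone ℝ (EuclideanSpace ℝ (Fin (m + 1))))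
    (hCpointed : ContainsNoLine (C : Set (EuclideanSpace ℝ (Fin (m + 1)))))
    (hCint : (interior (C : Set (EuclideanSpace ℝ (Fin (m + 1))))).Nonempty)
    (e : OrthonormalBasis (Fin (m + 1)) ℝ (EuclideanSpace ℝ (Fin (m + 1))))
    (he : IsAdaptedBasis (C : Set (EuclideanSpace ℝ (Fin (m + 1)))) e)
    (μ : Measure (Omega (C : Set (EuclideanSpace ℝ (Fin (m + 1))))))
    [IsLocallyFiniteMeasure μ]
    (K : Set (EuclideanSpace ℝ (Fin (m + 1))))
    (hK : IsCAsymptotic (C : Set (EuclideanSpace ℝ (Fin (m + 1)))) K)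
    (hS : ∀ η : Set (Omega (C : Set (EuclideanSpace ℝ (Fin (m + 1))))), MeasurableSet η →
      surfaceArea m K (Subtype.val '' η) = μ η) :
    ConvexOn ℝ (closure (PhiDomain (C : Set (EuclideanSpace ℝ (Fin (m + 1)))) e)) (uFun e K) ∧
    ContinuousOn (uFun e K) (closure (PhiDomain (C : Set (EuclideanSpace ℝ (Fin (m + 1)))) e)) ∧
    (∀ η ⊆ PhiDomain (C : Set (EuclideanSpace ℝ (Fin (m + 1)))) e, MeasurableSet η →
      mongeAmpere (closure (PhiDomain (C : Set (EuclideanSpace ℝ (Fin (m + 1)))) e))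
        (uFun e K) η = muTilde e μ η) ∧
    (∀ x ∈ frontier (PhiDomain (C : Set (EuclideanSpace ℝ (Fin (m + 1)))) e), uFun e K x = 0) :=
  theorem3p4_general m C e he.1 μ K hK hS
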